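/- Let $\mathcal S=\mathbb C[\pi_\lambda]$ be the polynomial ring in indeterminates indexed by all integer partitions $\lambda$. For a $k$-tuple $L=(L_1,\dots,L_k)$ of integers $\ge -k$, let $\widetilde\pi_L\in\mathcal S$ be $0$ if $L$ has a repeated entry, let $\widetilde\pi_L=\pi_\lambda$ with $\lambda_m=L_{k-m+1}+m$ $(1\le m\le k)$ if $L_1<\dots<L_k$, and extend to all $L$ with distinct entries by skew-symmetry. Let $\mathcal I\subset\mathcal S$ be the Plücker ideal defining the coordinate ring $\mathcal S/\mathcal I$ of the infinite Grassmannian, i.e. the ideal generated by all Plücker forms $$p_{I,J}=\sum_{m=1}^{k+1}(-1)^m\,\widetilde\pi_{I_1,\dots,I_{k-1},J_m}\,\widetilde\pi_{J_1,\dots,\widehat{J_m},\dots,J_{k+1}},$$ for all $1\le k\le n$ and all integer tuples $I=(I_1,\dots,I_{k-1})$, $J=(J_1,\dots,J_{k+1})$ with entries in $[-k,\,n-k-1]$. Write $(a_1,\dots,a_r|b_1,\dots,b_r)$ for the partition with Frobenius coordinates $a_1>\dots>a_r\ge0$ (arm lengths) and $b_1>\dots>b_r\ge0$ (leg lengths),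 and $\emptyset=(\emptyset|\emptyset)$ for the empty partition. **Proposition.** For all integers $0\le i<j<k$, the following seven elements of $\mathcal S$ belong to $\mathcal I$: \begin{align*} \kappa_1&=\pi_\emptyset(\pi_{(i|i)}\pi_{(k,j|k,j)}+\pi_{(j|k)}\pi_{(k,i|j,i)})-\pi_{(i|i)}\pi_{(j|j)}\pi_{(k|k)}+\pi_{(i|j)}\pi_{(j|k)}\pi_{(k|i)},\\ \kappa_2&=\pi_\emptyset(\pi_{(j|j)}\pi_{(k,i|k,i)}-\pi_{(k|i)}\pi_{(j,i|k,j)})-\pi_{(i|i)}\pi_{(j|j)}\pi_{(k|k)}+\pi_{(i|j)}\pi_{(j|k)}\pi_{(k|i)},\\ \kappa_3&=\pi_\emptyset(\pi_{(k|k)}\pi_{(j,i|j,i)}+\pi_{(i|j)}\pi_{(k,j|k,i)})-\pi_{(i|i)}\pi_{(j|j)}\pi_{(k|k)}+\pi_{(i|j)}\pi_{(j|k)}\pi_{(k|i)},\\ \kappa_1^T&=\pi_\emptyset(\pi_{(i|i)}\pi_{(k,j|k,j)}+\pi_{(k|j)}\pi_{(j,i|k,i)})-\pi_{(i|i)}\pi_{(j|j)}\pi_{(k|k)}+\pi_{(j|i)}\pi_{(k|j)}\pi_{(i|k)},\\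 \kappa_2^T&=\pi_\emptyset(\pi_{(j|j)}\pi_{(k,i|k,i)}-\pi_{(i|k)}\pi_{(k,j|j,i)})-\pi_{(i|i)}\pi_{(j|j)}\pi_{(k|k)}+\pi_{(j|i)}\pi_{(k|j)}\pi_{(i|k)},\\ \kappa_3^T&=\pi_\emptyset(\pi_{(k|k)}\pi_{(j,i|j,i)}+\pi_{(j|i)}\pi_{(k,i|k,j)})-\pi_{(i|i)}\pi_{(j|j)}\pi_{(k|k)}+\pi_{(j|i)}\pi_{(k|j)}\pi_{(i|k)},\\ \kappa_0&=\pi_\emptyset^2\,\pi_{(k,j,i|k,j,i)}\,\pi_{(i|j)}\pi_{(j|k)}\pi_{(k|i)}-(\pi_{(i|j)}\pi_{(j|k)}\pi_{(k|i)})^2\\ &\quad+\pi_{(i|j)}\pi_{(j|k)}\pi_{(k|i)}\bigl(2\pi_{(i|i)}\pi_{(j|j)}\pi_{(k|k)}-\pi_\emptyset(\pi_{(i|i)}\pi_{(k,j|k,j)}+\pi_{(j|j)}\pi_{(k,i|k,i)}+\pi_{(k|k)}\pi_{(j,i|j,i)})\bigr)\\ &\quad-(\pi_{(i|i)}\pi_{(j|j)}-\pi_\emptyset\pi_{(j,i|j,i)})(\pi_{(i|i)}\pi_{(k|k)}-\pi_\emptyset\pi_{(k,i|k,i)})(\pi_{(j|j)}\pi_{(k|k)}-\pi_\emptyset\pi_{(k,j|k,j)}).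 \end{align*} -/

import Mathlib

noncomputable section

namespace InfGrassmannian

open MvPolynomial

/-- The polynomial ring `𝒮 = ℂ[π_λ | λ a partition]`; partitions are represented by their
Young diagrams. -/
abbrev S : Type := MvPolynomial YoungDiagram ℂ

/-- The partition attached to a strictly increasing `k`-tuple `L_1 < ⋯ < L_k` of integers
`≥ -k`: it has the parts `λ_i = L_{k-i+1} + i` for `1 ≤ i ≤ k`
(rows are numbered from `0` below). -/
def partitionOf {k : ℕ} (L : Fin k → ℤ) (hL : StrictMono L) : YoungDiagram :=
  YoungDiagram.ofRowLens
    (List.ofFn fun r : Fin k => (L r.rev + (r : ℤ) + 1).toNat)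
    (by
      rw [List.sortedGE_ofFn_iff]
      have step : ∀ (d : ℕ) (r s : Fin k), (s : ℕ) = r + d →
          L s.rev + (s : ℤ) ≤ L r.rev + (r : ℤ) := by
        intro d
        induction d with
        | zero =>
          intro r s h
          have : s = r := Fin.ext (by simpa using h)
          rw [this]
        | succ d ih =>
          intro r s h
          have hlt : (r : ℕ) + d < k := by have := s.isLt; omega
          have h1 := ih r ⟨r + d, hlt⟩ rfl
          have h2 : L s.rev < L (Fin.rev ⟨r + d, hlt⟩) := by
            apply hL
            rw [Fin.rev_lt_rev, Fin.lt_def]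
            simp only
            omega
          simp only at h1
          push_cast at h1
          have h3 : (s : ℤ) = r + d + 1 := by rw [h]; push_cast; ring
          omega
      intro r s hrs
      apply Int.toNat_le_toNat
      have := step ((s : ℕ) - r) r s (by have := Fin.le_def.1 hrs; omega)
      omega)

/-- The coordinate `π̃_L` of an arbitrary `k`-tuple `L`, as an element of `𝒮`: it is `0` if `L`
has a repeated entry; otherwise it is the sign of the permutation that sorts `L` increasingly,
times `π_λ` for the partition `λ` attached to the sorted tuple. -/
def tupleCoord {k : ℕ} (L : Fin k → ℤ) : S :=
  open Classical in
  if h : Function.Injective L then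
    C (((Equiv.Perm.sign (Tuple.sort L) : ℤˣ) : ℤ) : ℂ) *
      X (partitionOf (L ∘ Tuple.sort L)
        ((Tuple.monotone_sort L).strictMono_of_injective
          (h.comp (Tuple.sort L).injective)))
  else 0

/-- The Plücker quadratic form
`p_{I,J} = ∑_{j=1}^{k+1} (-1)^j π̃_{I_1,…,I_{k-1},J_j} π̃_{J_1,…,Ĵ_j,…,J_{k+1}}`,
where `k = m + 1`. -/
def pluckerForm {m : ℕ} (I : Fin m → ℤ) (J : Fin (m + 2) → ℤ) : S :=
  ∑ j : Fin (m + 2), (-1) ^ ((j : ℕ) + 1) *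
    (tupleCoord (Fin.snoc (α := fun _ => ℤ) I (J j)) * tupleCoord (fun s => J (j.succAbove s)))

/-- The Plücker forms of the Grassmannian of `k`-dimensional subspaces of an `n`-dimensional
space: all `p_{I,J}` whose indices lie between `-k` and `n - k - 1`. -/
def pluckerForms : ℕ → ℕ → Set S
  | 0, _ => ∅
  | m + 1, n => {p | ∃ (I : Fin m → ℤ) (J : Fin (m + 2) → ℤ),
      (∀ s, -((m : ℤ) + 1) ≤ I s ∧ I s ≤ (n : ℤ) - ((m : ℤ) + 1) - 1) ∧
      (∀ s, -((m : ℤ) + 1) ≤ J s ∧ J s ≤ (n : ℤ) - ((m : ℤ) + 1) - 1) ∧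
      p = pluckerForm I J}

/-- The Plücker ideal `ℐ ⊂ 𝒮`, generated by the Plücker forms of all finite Grassmannians,
`0 ≤ k ≤ n`. -/
def pluckerIdeal : Ideal S :=
  Ideal.span (⋃ (k : ℕ) (n : ℕ) (_ : k ≤ n), pluckerForms k n)

/-- The partition with Frobenius coordinates `(a_1,…,a_r | b_1,…,b_r)`, where `a` and `b` are
strictly decreasing: the smallest Young diagram which contains, for every `t < r`, the cell
`(t, t + a_t)` at the end of the `t`-th arm and the cell `(t + b_t, t)` at the end of the `t`-th
leg (rows and columns numbered from `0`). -/
def frobenius {r : ℕ} (a b : Fin r → ℕ) : YoungDiagram where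
  cells := Finset.univ.biUnion fun t : Fin r =>
    (Finset.range (t + 1) ×ˢ Finset.range (t + a t + 1)) ∪
      (Finset.range (t + b t + 1) ×ˢ Finset.range (t + 1))
  isLowerSet := by
    rintro ⟨x, y⟩ ⟨x', y'⟩ ⟨hx, hy⟩ h
    simp only [Finset.coe_biUnion, Set.mem_iUnion, Finset.mem_coe, Finset.mem_union,
      Finset.mem_product, Finset.mem_range, Finset.mem_univ] at h ⊢
    simp only at hx hy
    obtain ⟨t, ht, h⟩ := h
    exact ⟨t, ht, by omega⟩

theorem mem_frobenius {r : ℕ} (a b : Fin r → ℕ) (x y : ℕ) :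
    (x, y) ∈ frobenius a b ↔
      ∃ t : Fin r, (x ≤ t ∧ y ≤ t + a t) ∨ (x ≤ t + b t ∧ y ≤ t) := by
  rw [← YoungDiagram.mem_cells]
  simp only [frobenius, Finset.mem_biUnion, Finset.mem_union, Finset.mem_product,
    Finset.mem_range, Finset.mem_univ, true_and, Nat.lt_succ_iff]

theorem add_le_of_strictAnti {r : ℕ} {a : Fin r → ℕ} (ha : StrictAnti a) :
    ∀ {s t : Fin r}, s ≤ t → (t : ℕ) + a t ≤ s + a s := by
  have step : ∀ (d : ℕ) (s t : Fin r), (t : ℕ) = s + d → (t : ℕ) + a t ≤ s + a s := by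
    intro d
    induction d with
    | zero =>
      intro s t h
      have : t = s := Fin.ext (by simpa using h)
      rw [this]
    | succ d ih =>
      intro s t h
      have hlt : (s : ℕ) + d < r := by have := t.isLt; omega
      have h1 := ih s ⟨s + d, hlt⟩ rfl
      have h2 : a t < a ⟨s + d, hlt⟩ := ha (Fin.lt_def.2 (by simp only; omega))
      simp only at h1
      omega
  intro s t h
  exact step ((t : ℕ) - s) s t (by have := Fin.le_def.1 h; omega)

/-- The `t`-th arm of `frobenius a b` has length `a_t`. -/
theorem rowLen_frobenius {r : ℕ} {a b : Fin r → ℕ} (ha : StrictAnti a)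
    (t : Fin r) : (frobenius a b).rowLen t = t + 1 + a t := by
  have key : ∀ y, y < (frobenius a b).rowLen t ↔ y < t + 1 + a t := by
    intro y
    rw [← YoungDiagram.mem_iff_lt_rowLen, mem_frobenius]
    constructor
    · rintro ⟨s, ⟨h1, h2⟩ | ⟨h1, h2⟩⟩
      · have := add_le_of_strictAnti ha (Fin.le_def.2 h1)
        omega
      · rcases le_total t s with h | h
        · have := add_le_of_strictAnti ha h
          omega
        · have := Fin.le_def.1 h
          omega
    · intro h
      exact ⟨t, Or.inl ⟨le_rfl, by omega⟩⟩
  exact le_antisymm (le_of_forall_lt fun y h => (key y).1 h)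
    (le_of_forall_lt fun y h => (key y).2 h)

/-- The `t`-th leg of `frobenius a b` has length `b_t`. -/
theorem colLen_frobenius {r : ℕ} {a b : Fin r → ℕ} (hb : StrictAnti b)
    (t : Fin r) : (frobenius a b).colLen t = t + 1 + b t := by
  have key : ∀ x, x < (frobenius a b).colLen t ↔ x < t + 1 + b t := by
    intro x
    rw [← YoungDiagram.mem_iff_lt_colLen, mem_frobenius]
    constructor
    · rintro ⟨s, ⟨h1, h2⟩ | ⟨h1, h2⟩⟩
      · rcases le_total t s with h | h
        · have := add_le_of_strictAnti hb h
          omega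
        · have := Fin.le_def.1 h
          omega
      · have := add_le_of_strictAnti hb (Fin.le_def.2 h2)
        omega
    · intro h
      exact ⟨t, Or.inr ⟨by omega, le_rfl⟩⟩
  exact le_antisymm (le_of_forall_lt fun y h => (key y).1 h)
    (le_of_forall_lt fun y h => (key y).2 h)

/-- The main diagonal of `frobenius a b` has exactly `r` cells. -/
theorem diag_mem_frobenius {r : ℕ} (a b : Fin r → ℕ) (t : ℕ) :
    (t, t) ∈ frobenius a b ↔ t < r := by
  rw [mem_frobenius]
  constructor
  · rintro ⟨s, h⟩
    have := s.isLt
    omega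
  · intro h
    exact ⟨⟨t, h⟩, Or.inl ⟨le_rfl, by simp⟩⟩

/-- The Plücker coordinate `π_(a|b)`, an indeterminate of `𝒮`, for a partition in Frobenius
notation. -/
def frobCoord {r : ℕ} (a b : Fin r → ℕ) : S := X (frobenius a b)

/-- `π_∅ = π_(∅|∅)` for the empty partition. -/
def emptyCoord : S := X ⊥

def kappa1 (i j k : ℕ) : S :=
  emptyCoord * (frobCoord ![i] ![i] * frobCoord ![k, j] ![k, j]
      + frobCoord ![j] ![k] * frobCoord ![k, i] ![j, i])
    - frobCoord ![i] ![i] * frobCoord ![j] ![j] * frobCoord ![k] ![k]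
    + frobCoord ![i] ![j] * frobCoord ![j] ![k] * frobCoord ![k] ![i]

def kappa2 (i j k : ℕ) : S :=
  emptyCoord * (frobCoord ![j] ![j] * frobCoord ![k, i] ![k, i]
      - frobCoord ![k] ![i] * frobCoord ![j, i] ![k, j])
    - frobCoord ![i] ![i] * frobCoord ![j] ![j] * frobCoord ![k] ![k]
    + frobCoord ![i] ![j] * frobCoord ![j] ![k] * frobCoord ![k] ![i]

def kappa3 (i j k : ℕ) : S :=
  emptyCoord * (frobCoord ![k] ![k] * frobCoord ![j, i] ![j, i]
      + frobCoord ![i] ![j] * frobCoord ![k, j] ![k, i])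
    - frobCoord ![i] ![i] * frobCoord ![j] ![j] * frobCoord ![k] ![k]
    + frobCoord ![i] ![j] * frobCoord ![j] ![k] * frobCoord ![k] ![i]

def kappa1T (i j k : ℕ) : S :=
  emptyCoord * (frobCoord ![i] ![i] * frobCoord ![k, j] ![k, j]
      + frobCoord ![k] ![j] * frobCoord ![j, i] ![k, i])
    - frobCoord ![i] ![i] * frobCoord ![j] ![j] * frobCoord ![k] ![k]
    + frobCoord ![j] ![i] * frobCoord ![k] ![j] * frobCoord ![i] ![k]

def kappa2T (i j k : ℕ) : S :=
  emptyCoord * (frobCoord ![j] ![j] * frobCoord ![k, i] ![k, i]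
      - frobCoord ![i] ![k] * frobCoord ![k, j] ![j, i])
    - frobCoord ![i] ![i] * frobCoord ![j] ![j] * frobCoord ![k] ![k]
    + frobCoord ![j] ![i] * frobCoord ![k] ![j] * frobCoord ![i] ![k]

def kappa3T (i j k : ℕ) : S :=
  emptyCoord * (frobCoord ![k] ![k] * frobCoord ![j, i] ![j, i]
      + frobCoord ![j] ![i] * frobCoord ![k, i] ![k, j])
    - frobCoord ![i] ![i] * frobCoord ![j] ![j] * frobCoord ![k] ![k]
    + frobCoord ![j] ![i] * frobCoord ![k] ![j] * frobCoord ![i] ![k]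

def kappa0 (i j k : ℕ) : S :=
  emptyCoord ^ 2 * frobCoord ![k, j, i] ![k, j, i]
      * frobCoord ![i] ![j] * frobCoord ![j] ![k] * frobCoord ![k] ![i]
    - (frobCoord ![i] ![j] * frobCoord ![j] ![k] * frobCoord ![k] ![i]) ^ 2
    + (frobCoord ![i] ![j] * frobCoord ![j] ![k] * frobCoord ![k] ![i])
      * (2 * frobCoord ![i] ![i] * frobCoord ![j] ![j] * frobCoord ![k] ![k]
        - emptyCoord * (frobCoord ![i] ![i] * frobCoord ![k, j] ![k, j]
          + frobCoord ![j] ![j] * frobCoord ![k, i] ![k, i]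
          + frobCoord ![k] ![k] * frobCoord ![j, i] ![j, i]))
    - (frobCoord ![i] ![i] * frobCoord ![j] ![j]
        - emptyCoord * frobCoord ![j, i] ![j, i])
      * (frobCoord ![i] ![i] * frobCoord ![k] ![k]
        - emptyCoord * frobCoord ![k, i] ![k, i])
      * (frobCoord ![j] ![j] * frobCoord ![k] ![k]
        - emptyCoord * frobCoord ![k, j] ![k, j])

end InfGrassmannian

end

noncomputable section

namespace InfGrassmannian

open MvPolynomial

/-! Modulo the Plücker ideal, `π_∅` times a coordinate with two diagonal cells is a 2×2 minor of the
matrix `(π_(a|b))` (`giambelli_two`), and `π_∅² π_(k,j,i|k,j,i)` is a 3×3 minor, by Laplace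
expansion (`giambelli_three`). All seven elements then vanish by polynomial identities in the nine
entries with indices `i, j, k`. Each Giambelli relation is a single Plücker form. Tuples record
partitions by removing the integers `-(b_t+1)` from the vacuum `-n,…,-1` and adding the `a_t`. With
`m = b₁`, take `I = (-m,…,-1)` and let `J` be the tuple of the large partition preceded by `-(m+1)`.
Entries of `J` already in `I` contribute nothing; `-(m+1)` completes `I` to the vacuum, and each
`a_t` completes it to the hook `(a_t|b₁)`. -/

/-! ### Coordinates of sorted and permuted tuples -/

theorem mem_partitionOf {k : ℕ} {L : Fin k → ℤ} (hL : StrictMono L) (x y : ℕ) :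
    (x, y) ∈ partitionOf L hL ↔ ∃ h : x < k, (y : ℤ) < L (Fin.rev ⟨x, h⟩) + x + 1 := by
  simp [partitionOf, YoungDiagram.mem_ofRowLens, Int.lt_toNat]

theorem tupleCoord_of_not_injective {k : ℕ} {L : Fin k → ℤ} (h : ¬ Function.Injective L) :
    tupleCoord L = 0 := by
  simp [tupleCoord, h]

/-- The increasing rearrangement is unique, so sorting `L ∘ σ` undoes `σ`, and `σ⁻¹` has the sign of
`σ`. -/
theorem tupleCoord_comp_perm {k : ℕ} {L : Fin k → ℤ} (hL : StrictMono L)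
    (σ : Equiv.Perm (Fin k)) :
    tupleCoord (L ∘ σ) =
      C (((Equiv.Perm.sign σ : ℤˣ) : ℤ) : ℂ) * X (partitionOf L hL) := by
  have hinj : Function.Injective (L ∘ σ) := hL.injective.comp σ.injective
  have hcomp : (L ∘ σ) ∘ Tuple.sort (L ∘ σ) = L := by
    have h : (L ∘ σ) ∘ ⇑(σ⁻¹) = L := by ext s; simp
    rw [← Tuple.comp_sort_eq_comp_iff_monotone.2 (h.symm ▸ hL.monotone), h]
  have hsort : Tuple.sort (L ∘ σ) = σ⁻¹ := by
    ext s
    have h := congrFun hcomp s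
    have h' := hL.injective h
    rw [Equiv.Perm.eq_inv_iff_eq.2 h']
  rw [tupleCoord, dif_pos hinj]
  congr 2
  · rw [hsort, Equiv.Perm.sign_inv]
  · congr 1

theorem tupleCoord_of_strictMono {k : ℕ} {L : Fin k → ℤ} (hL : StrictMono L) {μ : YoungDiagram}
    (h : ∀ x y : ℕ, (x, y) ∈ μ ↔ ∃ h : x < k, (y : ℤ) < L (Fin.rev ⟨x, h⟩) + x + 1) :
    tupleCoord L = X μ := by
  have hμ : partitionOf L hL = μ := by
    ext ⟨x, y⟩
    rw [YoungDiagram.mem_cells, YoungDiagram.mem_cells, mem_partitionOf, h]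
  simpa [hμ] using tupleCoord_comp_perm hL 1

/-! ### Tuples of partitions with at most three diagonal cells -/

/-- The increasing tuple of the empty partition. -/
def vacuum (n s : ℕ) : ℤ := s - n

/-- The increasing tuple of the partition `(a | b)`. -/
def hook (n a b s : ℕ) : ℤ :=
  if s + b + 1 < n then s - n else if s + 1 < n then s + 1 - n else a

/-- The increasing tuple of the partition `(a₁, a₂ | b₁, b₂)`. -/
def doubleHook (n a₁ a₂ b₁ b₂ s : ℕ) : ℤ :=
  if s + b₁ + 1 < n then s - n else if s + b₂ + 2 < n then s + 1 - n else
  if s + 2 < n then s + 2 - n else if s + 1 < n then a₂ else a₁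

/-- The increasing tuple of the partition `(a₁, a₂, a₃ | b₁, b₂, b₃)`. -/
def tripleHook (n a₁ a₂ a₃ b₁ b₂ b₃ s : ℕ) : ℤ :=
  if s + b₁ + 1 < n then s - n else if s + b₂ + 2 < n then s + 1 - n else
  if s + b₃ + 3 < n then s + 2 - n else if s + 3 < n then s + 3 - n else
  if s + 2 < n then a₃ else if s + 1 < n then a₂ else a₁

theorem tupleCoord_vacuum {n : ℕ} {L : Fin n → ℤ} (hL : ∀ s, L s = vacuum n s) :
    tupleCoord L = emptyCoord := by
  apply tupleCoord_of_strictMono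
  · intro s t hst
    rw [hL, hL, vacuum, vacuum]
    have := Fin.lt_def.1 hst
    omega
  · intro x y
    simp only [YoungDiagram.notMem_bot, false_iff, not_exists]
    intro h
    rw [hL, vacuum, Fin.val_rev]
    simp only
    omega

/-- The bound on `b` says that the `b + 1` rows fit, i.e. that `-(b+1)` is present in the vacuum and
can be removed. -/
theorem tupleCoord_hook {n a b : ℕ} (hb : b < n) {L : Fin n → ℤ}
    (hL : ∀ s, L s = hook n a b s) :
    tupleCoord L = frobCoord ![a] ![b] := by
  apply tupleCoord_of_strictMono
  · intro s t hst
    rw [hL, hL, hook, hook]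
    have := Fin.lt_def.1 hst
    have := t.isLt
    split_ifs <;> omega
  · intro x y
    simp only [mem_frobenius, Fin.exists_fin_one, Matrix.cons_val_zero, Fin.val_zero]
    by_cases h : x < n
    · simp only [h, exists_true_left, hL, hook, Fin.val_rev]
      split_ifs <;> omega
    · simp only [h, IsEmpty.exists_iff, iff_false]
      omega

theorem tupleCoord_doubleHook {n a₁ a₂ b₁ b₂ : ℕ} (ha : a₂ < a₁) (hb : b₂ < b₁) (hn : b₁ < n)
    {L : Fin n → ℤ} (hL : ∀ s, L s = doubleHook n a₁ a₂ b₁ b₂ s) :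
    tupleCoord L = frobCoord ![a₁, a₂] ![b₁, b₂] := by
  apply tupleCoord_of_strictMono
  · intro s t hst
    rw [hL, hL, doubleHook, doubleHook]
    have := Fin.lt_def.1 hst
    have := t.isLt
    split_ifs <;> omega
  · intro x y
    simp only [mem_frobenius, Fin.exists_fin_two, Matrix.cons_val_zero, Matrix.cons_val_one,
      Fin.val_zero, Fin.val_one]
    by_cases h : x < n
    · simp only [h, exists_true_left, hL, doubleHook, Fin.val_rev]
      split_ifs <;> omega
    · simp only [h, IsEmpty.exists_iff, iff_false]
      omega

theorem tupleCoord_tripleHook {n a₁ a₂ a₃ b₁ b₂ b₃ : ℕ} (ha : a₂ < a₁) (ha' : a₃ < a₂)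
    (hb : b₂ < b₁) (hb' : b₃ < b₂) (hn : b₁ < n)
    {L : Fin n → ℤ} (hL : ∀ s, L s = tripleHook n a₁ a₂ a₃ b₁ b₂ b₃ s) :
    tupleCoord L = frobCoord ![a₁, a₂, a₃] ![b₁, b₂, b₃] := by
  apply tupleCoord_of_strictMono
  · intro s t hst
    rw [hL, hL, tripleHook, tripleHook]
    have := Fin.lt_def.1 hst
    have := t.isLt
    split_ifs <;> omega
  · intro x y
    have hex : ∀ P : Fin 3 → Prop, (∃ t, P t) ↔ P 0 ∨ P 1 ∨ P 2 := fun P => by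
      simp [Fin.exists_fin_succ]
    rw [mem_frobenius, hex]
    simp only [Matrix.cons_val_zero, Matrix.cons_val_one, Matrix.cons_val, Fin.val_zero,
      Fin.val_one, Fin.val_two]
    by_cases h : x < n
    · simp only [h, exists_true_left, hL, tripleHook, Fin.val_rev]
      split_ifs <;> omega
    · simp only [h, IsEmpty.exists_iff, iff_false]
      omega

/-! ### Completing the tuple `-m,…,-1` by one entry -/

/-- The increasing tuple of all integers from `-m` to `-1`. -/
def shortVacuum (m : ℕ) (s : Fin m) : ℤ := s - m

theorem tupleCoord_snoc_shortVacuum_of_nonneg (m a : ℕ) :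
    tupleCoord (Fin.snoc (α := fun _ => ℤ) (shortVacuum m) (a : ℤ)) = frobCoord ![a] ![m] := by
  refine tupleCoord_hook (n := m + 1) (by omega) fun s => ?_
  induction s using Fin.lastCases with
  | last => simp only [Fin.snoc_last, hook, Fin.val_last]; split_ifs <;> omega
  | cast s =>
    have := s.isLt
    simp only [Fin.snoc_castSucc, hook, shortVacuum, Fin.val_castSucc]
    split_ifs <;> push_cast <;> omega

/-- The new entry is the smallest; moving it to the front is a cycle of length `m + 1`, which gives
the sign. -/
theorem tupleCoord_snoc_shortVacuum_of_eq (m : ℕ) :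
    tupleCoord (Fin.snoc (α := fun _ => ℤ) (shortVacuum m) (-(m + 1) : ℤ)) =
      (-1) ^ m * emptyCoord := by
  have hmono : StrictMono fun s : Fin (m + 1) => vacuum (m + 1) s := fun s t hst => by
    have := Fin.lt_def.1 hst
    simp only [vacuum]
    omega
  have hσ : Fin.snoc (α := fun _ => ℤ) (shortVacuum m) (-(m + 1) : ℤ) =
      (fun s : Fin (m + 1) => vacuum (m + 1) s) ∘ finRotate (m + 1) := by
    ext s
    induction s using Fin.lastCases with
    | last => simp [vacuum]
    | cast s => simp [vacuum, shortVacuum, Fin.coeSucc_eq_succ]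
  have hcoord : X (partitionOf _ hmono) = emptyCoord := by
    rw [← tupleCoord_vacuum (L := fun s : Fin (m + 1) => vacuum (m + 1) s) fun _ => rfl]
    simpa using (tupleCoord_comp_perm hmono 1).symm
  rw [hσ, tupleCoord_comp_perm hmono, hcoord, sign_finRotate]
  simp

theorem tupleCoord_snoc_shortVacuum_of_mem {m : ℕ} {z : ℤ} (h₁ : -(m : ℤ) ≤ z) (h₂ : z < 0) :
    tupleCoord (Fin.snoc (α := fun _ => ℤ) (shortVacuum m) z) = 0 := by
  apply tupleCoord_of_not_injective
  intro h
  have h' := @h (Fin.castSucc ⟨(z + m).toNat, by omega⟩) (Fin.last m) (by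
    simp only [Fin.snoc_castSucc, Fin.snoc_last, shortVacuum]
    omega)
  exact (Fin.castSucc_lt_last _).ne h'

theorem pluckerForm_mem_pluckerIdeal {m : ℕ} (c : ℕ) {I : Fin m → ℤ} {J : Fin (m + 2) → ℤ}
    (hI : ∀ s, -((m : ℤ) + 1) ≤ I s ∧ I s ≤ c) (hJ : ∀ s, -((m : ℤ) + 1) ≤ J s ∧ J s ≤ c) :
    pluckerForm I J ∈ pluckerIdeal := by
  apply Ideal.subset_span
  simp only [Set.mem_iUnion]
  -- This `n` makes the upper bound `n - k - 1` equal to `c`.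
  refine ⟨m + 1, m + 1 + c + 1, by omega, I, J, fun s => ?_, fun s => ?_, rfl⟩
  · have := hI s
    push_cast
    omega
  · have := hJ s
    push_cast
    omega

theorem val_succAbove_eq_ite {n : ℕ} (p : Fin (n + 1)) (s : Fin n) :
    (p.succAbove s : ℕ) = if (s : ℕ) < p then (s : ℕ) else s + 1 := by
  simp only [Fin.succAbove, Fin.lt_def, Fin.val_castSucc]
  split_ifs <;> simp

/-! ### Giambelli relations -/

/-- The Giambelli relation for partitions with two diagonal cells. -/
theorem giambelli_two {a₁ a₂ b₁ b₂ : ℕ} (ha : a₂ < a₁) (hb : b₂ < b₁) :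
    emptyCoord * frobCoord ![a₁, a₂] ![b₁, b₂]
      - (frobCoord ![a₁] ![b₁] * frobCoord ![a₂] ![b₂]
        - frobCoord ![a₂] ![b₁] * frobCoord ![a₁] ![b₂]) ∈ pluckerIdeal := by
  obtain ⟨m, rfl⟩ : ∃ m, m = b₁ := ⟨_, rfl⟩
  let I : Fin m → ℤ := shortVacuum m
  -- The tuple of `(a₁,a₂|m,b₂)` with its missing entry `-(m+1)` restored in front.
  let J : Fin (m + 2) → ℤ := fun s =>
    if (s : ℕ) + b₂ < m then (s : ℤ) - (m + 1) else if (s : ℕ) < m then (s : ℤ) - m else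
    if (s : ℕ) < m + 1 then (a₂ : ℤ) else a₁
  have hmem : pluckerForm I J ∈ pluckerIdeal := by
    apply pluckerForm_mem_pluckerIdeal a₁
    · intro s
      simp only [I, shortVacuum]
      omega
    · intro s
      simp only [J]
      split_ifs <;> omega
  let p : Fin (m + 2) := ⟨0, by omega⟩
  let q : Fin (m + 2) := ⟨m, by omega⟩
  let r : Fin (m + 2) := ⟨m + 1, by omega⟩
  have hpq : p ≠ q := by simp only [p, q, ne_eq, Fin.mk.injEq]; omega
  have hpr : p ≠ r := by simp [p, r]
  have hqr : q ≠ r := by simp [q, r]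
  have hJp : J p = -(m + 1) := by simp only [J, p]; split_ifs <;> omega
  have hJq : J q = a₂ := by simp only [J, q]; split_ifs <;> omega
  have hJr : J r = a₁ := by simp only [J, r]; split_ifs <;> omega
  have hp : tupleCoord (fun s => J (p.succAbove s)) = frobCoord ![a₁, a₂] ![m, b₂] := by
    refine tupleCoord_doubleHook (n := m + 1) ha hb (by omega) fun s => ?_
    have h := val_succAbove_eq_ite p s
    have := s.isLt
    simp only [J, doubleHook]
    generalize (p.succAbove s : ℕ) = v at h ⊢
    simp only [p] at h
    split_ifs at h ⊢ <;> omega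
  have hq : tupleCoord (fun s => J (q.succAbove s)) = frobCoord ![a₁] ![b₂] := by
    refine tupleCoord_hook (n := m + 1) (by omega) fun s => ?_
    have h := val_succAbove_eq_ite q s
    have := s.isLt
    simp only [J, hook]
    generalize (q.succAbove s : ℕ) = v at h ⊢
    simp only [q] at h
    split_ifs at h ⊢ <;> omega
  have hr : tupleCoord (fun s => J (r.succAbove s)) = frobCoord ![a₂] ![b₂] := by
    refine tupleCoord_hook (n := m + 1) (by omega) fun s => ?_
    have h := val_succAbove_eq_ite r s
    have := s.isLt
    simp only [J, hook]
    generalize (r.succAbove s : ℕ) = v at h ⊢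
    simp only [r] at h
    split_ifs at h ⊢ <;> omega
  -- Every other entry of `J` lies in `[-m, -1]` and so repeats an entry of `I`.
  have hsum : pluckerForm I J = ∑ s ∈ {p, q, r}, (-1) ^ ((s : ℕ) + 1) *
      (tupleCoord (Fin.snoc (α := fun _ => ℤ) I (J s)) * tupleCoord (fun t => J (s.succAbove t))) := by
    refine (Finset.sum_subset (Finset.subset_univ _) fun s _ hs => ?_).symm
    simp only [Finset.mem_insert, Finset.mem_singleton, not_or, Fin.ext_iff, p, q, r] at hs
    rw [tupleCoord_snoc_shortVacuum_of_mem, zero_mul, mul_zero] <;>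
    · simp only [J]
      split_ifs <;> omega
  rw [hsum, Finset.sum_insert (by simp [hpq, hpr]), Finset.sum_insert (by simp [hqr]),
    Finset.sum_singleton, hJp, hJq, hJr, hp, hq, hr, tupleCoord_snoc_shortVacuum_of_eq,
    tupleCoord_snoc_shortVacuum_of_nonneg, tupleCoord_snoc_shortVacuum_of_nonneg] at hmem
  have hsq : ((-1 : S) ^ m) * (-1) ^ m = 1 := by rw [← mul_pow]; simp
  -- This unit makes the coefficient of the `emptyCoord` term equal to `1`.
  convert pluckerIdeal.mul_mem_left (-(-1) ^ m) hmem using 1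
  simp only [p, q, r]
  linear_combination (-emptyCoord * frobCoord ![a₁, a₂] ![m, b₂]
    + frobCoord ![a₁] ![m] * frobCoord ![a₂] ![b₂]
    - frobCoord ![a₂] ![m] * frobCoord ![a₁] ![b₂]) * hsq

set_option maxHeartbeats 2000000 in
/-- The expansion of a Plücker coordinate with three diagonal cells along its longest leg. -/
theorem giambelli_three {a₁ a₂ a₃ b₁ b₂ b₃ : ℕ} (ha : a₂ < a₁) (ha' : a₃ < a₂)
    (hb : b₂ < b₁) (hb' : b₃ < b₂) :
    emptyCoord * frobCoord ![a₁, a₂, a₃] ![b₁, b₂, b₃]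
      - (frobCoord ![a₁] ![b₁] * frobCoord ![a₂, a₃] ![b₂, b₃]
        - frobCoord ![a₂] ![b₁] * frobCoord ![a₁, a₃] ![b₂, b₃]
        + frobCoord ![a₃] ![b₁] * frobCoord ![a₁, a₂] ![b₂, b₃]) ∈ pluckerIdeal := by
  obtain ⟨m, rfl⟩ : ∃ m, m = b₁ := ⟨_, rfl⟩
  let I : Fin m → ℤ := shortVacuum m
  let J : Fin (m + 2) → ℤ := fun s =>
    if (s : ℕ) + b₂ < m then (s : ℤ) - (m + 1) else if (s : ℕ) + b₃ + 1 < m then (s : ℤ) - m else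
    if (s : ℕ) + 1 < m then (s : ℤ) + 1 - m else if (s : ℕ) < m then (a₃ : ℤ) else
    if (s : ℕ) < m + 1 then (a₂ : ℤ) else a₁
  have hmem : pluckerForm I J ∈ pluckerIdeal := by
    apply pluckerForm_mem_pluckerIdeal a₁
    · intro s
      simp only [I, shortVacuum]
      omega
    · intro s
      simp only [J]
      split_ifs <;> omega
  let p : Fin (m + 2) := ⟨0, by omega⟩
  -- The position of `a₃`; the subtraction is not truncated, since `b₃ < b₂ < m`.
  let o : Fin (m + 2) := ⟨m - 1, by omega⟩
  let q : Fin (m + 2) := ⟨m, by omega⟩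
  let r : Fin (m + 2) := ⟨m + 1, by omega⟩
  have hpo : p ≠ o := by simp only [p, o, ne_eq, Fin.mk.injEq]; omega
  have hpq : p ≠ q := by simp only [p, q, ne_eq, Fin.mk.injEq]; omega
  have hpr : p ≠ r := by simp [p, r]
  have hoq : o ≠ q := by simp only [o, q, ne_eq, Fin.mk.injEq]; omega
  have hor : o ≠ r := by simp only [o, r, ne_eq, Fin.mk.injEq]; omega
  have hqr : q ≠ r := by simp [q, r]
  have hJp : J p = -(m + 1) := by simp only [J, p]; split_ifs <;> omega
  have hJo : J o = a₃ := by simp only [J, o]; split_ifs <;> omega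
  have hJq : J q = a₂ := by simp only [J, q]; split_ifs <;> omega
  have hJr : J r = a₁ := by simp only [J, r]; split_ifs <;> omega
  have hp : tupleCoord (fun s => J (p.succAbove s)) =
      frobCoord ![a₁, a₂, a₃] ![m, b₂, b₃] := by
    refine tupleCoord_tripleHook (n := m + 1) ha ha' hb hb' (by omega) fun s => ?_
    have h := val_succAbove_eq_ite p s
    have := s.isLt
    simp only [J, tripleHook]
    generalize (p.succAbove s : ℕ) = v at h ⊢
    simp only [p] at h
    split_ifs at h ⊢ <;> omega
  have ho : tupleCoord (fun s => J (o.succAbove s)) = frobCoord ![a₁, a₂] ![b₂, b₃] := by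
    refine tupleCoord_doubleHook (n := m + 1) ha hb' (by omega) fun s => ?_
    have h := val_succAbove_eq_ite o s
    have := s.isLt
    simp only [J, doubleHook]
    generalize (o.succAbove s : ℕ) = v at h ⊢
    simp only [o] at h
    split_ifs at h ⊢ <;> omega
  have hq : tupleCoord (fun s => J (q.succAbove s)) = frobCoord ![a₁, a₃] ![b₂, b₃] := by
    refine tupleCoord_doubleHook (n := m + 1) (ha'.trans ha) hb' (by omega) fun s => ?_
    have h := val_succAbove_eq_ite q s
    have := s.isLt
    simp only [J, doubleHook]
    generalize (q.succAbove s : ℕ) = v at h ⊢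
    simp only [q] at h
    split_ifs at h ⊢ <;> omega
  have hr : tupleCoord (fun s => J (r.succAbove s)) = frobCoord ![a₂, a₃] ![b₂, b₃] := by
    refine tupleCoord_doubleHook (n := m + 1) ha' hb' (by omega) fun s => ?_
    have h := val_succAbove_eq_ite r s
    have := s.isLt
    simp only [J, doubleHook]
    generalize (r.succAbove s : ℕ) = v at h ⊢
    simp only [r] at h
    split_ifs at h ⊢ <;> omega
  have hsum : pluckerForm I J = ∑ s ∈ {p, o, q, r}, (-1) ^ ((s : ℕ) + 1) *
      (tupleCoord (Fin.snoc (α := fun _ => ℤ) I (J s)) * tupleCoord (fun t => J (s.succAbove t))) := by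
    refine (Finset.sum_subset (Finset.subset_univ _) fun s _ hs => ?_).symm
    simp only [Finset.mem_insert, Finset.mem_singleton, not_or, Fin.ext_iff, p, o, q, r] at hs
    rw [tupleCoord_snoc_shortVacuum_of_mem, zero_mul, mul_zero] <;>
    · simp only [J]
      split_ifs <;> omega
  rw [hsum, Finset.sum_insert (by simp [hpo, hpq, hpr]), Finset.sum_insert (by simp [hoq, hor]),
    Finset.sum_insert (by simp [hqr]), Finset.sum_singleton, hJp, hJo, hJq, hJr, hp, ho, hq, hr,
    tupleCoord_snoc_shortVacuum_of_eq, tupleCoord_snoc_shortVacuum_of_nonneg,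
    tupleCoord_snoc_shortVacuum_of_nonneg, tupleCoord_snoc_shortVacuum_of_nonneg] at hmem
  have hsq : ((-1 : S) ^ m) * (-1) ^ m = 1 := by rw [← mul_pow]; simp
  have ho' : (o : ℕ) + 1 = m := by simp only [o]; omega
  convert pluckerIdeal.mul_mem_left (-(-1) ^ m) hmem using 1
  rw [ho']
  simp only [p, q, r]
  linear_combination (-emptyCoord * frobCoord ![a₁, a₂, a₃] ![m, b₂, b₃]
    + frobCoord ![a₁] ![m] * frobCoord ![a₂, a₃] ![b₂, b₃]
    - frobCoord ![a₂] ![m] * frobCoord ![a₁, a₃] ![b₂, b₃]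
    + frobCoord ![a₃] ![m] * frobCoord ![a₁, a₂] ![b₂, b₃]) * hsq

end InfGrassmannian

/-! ### The seven relations -/

open InfGrassmannian in
theorem mainTheorem6 (i j k : ℕ) (hij : i < j) (hjk : j < k) :
    InfGrassmannian.kappa1 i j k ∈ InfGrassmannian.pluckerIdeal ∧
    InfGrassmannian.kappa2 i j k ∈ InfGrassmannian.pluckerIdeal ∧
    InfGrassmannian.kappa3 i j k ∈ InfGrassmannian.pluckerIdeal ∧
    InfGrassmannian.kappa1T i j k ∈ InfGrassmannian.pluckerIdeal ∧
    InfGrassmannian.kappa2T i j k ∈ InfGrassmannian.pluckerIdeal ∧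
    InfGrassmannian.kappa3T i j k ∈ InfGrassmannian.pluckerIdeal ∧
    InfGrassmannian.kappa0 i j k ∈ InfGrassmannian.pluckerIdeal := by
  have two {a₁ a₂ b₁ b₂ : ℕ} (ha : a₂ < a₁) (hb : b₂ < b₁) :=
    Ideal.Quotient.eq_zero_iff_mem.2 (giambelli_two ha hb)
  have three := Ideal.Quotient.eq_zero_iff_mem.2 (giambelli_three hjk hij hjk hij)
  have hik := hij.trans hjk
  have jiji := two hij hij
  have jiki := two hij hik
  have jikj := two hij hjk
  have kiji := two hik hij
  have kiki := two hik hik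
  have kikj := two hik hjk
  have kjji := two hjk hij
  have kjki := two hjk hik
  have kjkj := two hjk hjk
  clear two
  simp only [← Ideal.Quotient.eq_zero_iff_mem, kappa1, kappa2, kappa3, kappa1T, kappa2T, kappa3T,
    kappa0, map_add, map_sub, map_mul, map_pow, map_ofNat] at *
  set f := Ideal.Quotient.mk pluckerIdeal
  set e := f emptyCoord
  set ii := f (frobCoord ![i] ![i])
  set ij := f (frobCoord ![i] ![j])
  set ik := f (frobCoord ![i] ![k])
  set ji := f (frobCoord ![j] ![i])
  set jj := f (frobCoord ![j] ![j])
  set jk := f (frobCoord ![j] ![k])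
  set ki := f (frobCoord ![k] ![i])
  set kj := f (frobCoord ![k] ![j])
  set kk := f (frobCoord ![k] ![k])
  refine ⟨?_, ?_, ?_, ?_, ?_, ?_, ?_⟩
  -- In each of the first six, the two 2×2 minors share a monomial that cancels, leaving the
  -- diagonal product and a 3-cycle.
  · linear_combination ii * kjkj + jk * kiji
  · linear_combination jj * kiki - ki * jikj
  · linear_combination kk * jiji + ij * kjki
  · linear_combination ii * kjkj + kj * jiki
  · linear_combination jj * kiki - ik * kjji
  · linear_combination kk * jiji + ji * kikj
  -- The first bracket turns `e² π_(k,j,i|k,j,i)` into the full 3×3 determinant.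
  · linear_combination ij * jk * ki * (e * three + kk * jiji - jk * kiji + ik * kjji)
      - ij * jk * ki * (ii * kjkj + jj * kiki + kk * jiji)
      -- The product of three differences is reduced one factor at a time to `ij·ji·ik·ki·jk·kj`,
      -- the product of the two 3-cycles.
      + jiji * (ii * kk - e * f (frobCoord ![k, i] ![k, i]))
        * (jj * kk - e * f (frobCoord ![k, j] ![k, j]))
      + ij * ji * kiki * (jj * kk - e * f (frobCoord ![k, j] ![k, j]))
      + ij * ji * ik * ki * kjkj
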